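/- Call a map $f : S \to G$ from a nonempty commutative semigroup $(S,+)$ to a group $G$ a polynomial map of degree $\le -\infty$ if $f \equiv 1_G$, of degree $\le 0$ if $f$ is constant, and, inductively, of degree $\le d+1$ ($d \in \mathbb{N}_0$) if for every $s \in S$ both maps $t \mapsto f(s+t) f(t)^{-1}$ and $t \mapsto f(t)^{-1} f(s+t)$ are polynomial maps of degree $\le d$. A polynomial map is a polynomial map of degree $\le d$ for some $d \in \mathbb{N}_0 \cup \{-\infty\}$. Let $N, n \ge 0$ be integers, let $\mathcal{U}_n(\mathbb{R})$ be the group of upper unitriangular real $n \times n$ matrices with its usual topology, and regard $\mathbb{R}$ as an additive group and $\mathbb{R}_{\ge 0}^N$ as an additive semigroup. Theorem. For $1 \le i < j \le n$ let $f_{i,j} : \mathbb{R}_{\ge 0}^N \to \mathbb{R}$ be continuous polynomial maps of degree $\le d_{i,j}$, where $d_{i,j} \in \mathbb{N}_0 \cup \{-\infty\}$, and let $f : \mathbb{R}_{\ge 0}^N \to \mathcal{U}_n(\mathbb{R})$ be the function whose $(i,j)$ entry is $f_{i,j}$ for all $i < j$. Then $f$ is a continuous polynomial map. Conversely, let $f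 : \mathbb{R}_{\ge 0}^N \to \mathcal{U}_n(\mathbb{R})$ be a continuous polynomial map. Then each entry $f_{i,j} : \mathbb{R}_{\ge 0}^N \to \mathbb{R}$ with $1 \le i < j \le n$ is a continuous polynomial map, and it is given by an ordinary polynomial: there is $p_{i,j} \in \mathbb{R}[x_1, \dots, x_N]$ with $f_{i,j}(x) = p_{i,j}(x)$ for all $x \in \mathbb{R}_{\ge 0}^N$. -/

import Mathlib

open scoped NNReal

/-- The left forward difference `t ↦ f (s + t) * (f t)⁻¹`. -/
def leftDiff {S G : Type*} [AddCommSemigroup S] [Group G] (s : S) (f : S → G) : S → G :=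
  fun t => f (s + t) * (f t)⁻¹

/-- The right forward difference `t ↦ (f t)⁻¹ * f (s + t)`. -/
def rightDiff {S G : Type*} [AddCommSemigroup S] [Group G] (s : S) (f : S → G) : S → G :=
  fun t => (f t)⁻¹ * f (s + t)

/-- Polynomial maps of degree at most a natural number: degree at most `0` means constant, and
degree at most `d + 1` means that all left and right differences have degree at most `d`. -/
def IsPolyMapNatDegreeLE {S G : Type*} [AddCommSemigroup S] [Group G] : ℕ → (S → G) → Prop
  | 0, f => ∃ c : G, ∀ t, f t = c
  | d + 1, f => ∀ s : S, IsPolyMapNatDegreeLE d (leftDiff s f) ∧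
      IsPolyMapNatDegreeLE d (rightDiff s f)

/-- Polynomial maps of degree at most `d`, where `d` is a natural number or `⊥` (that is, `-∞`);
degree at most `-∞` means identically `1`. -/
def IsPolyMapOfDegreeLE {S G : Type*} [AddCommSemigroup S] [Group G] (d : WithBot ℕ)
    (f : S → G) : Prop :=
  match d with
  | ⊥ => ∀ t, f t = 1
  | (k : ℕ) => IsPolyMapNatDegreeLE k f

/-- Polynomial maps from a commutative semigroup to a group: those of degree at most some `d`. -/
def IsPolyMap {S G : Type*} [AddCommSemigroup S] [Group G] (f : S → G) : Prop :=
  ∃ d : WithBot ℕ, IsPolyMapOfDegreeLE d f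

/-- Upper unitriangular real `n × n` matrices, as a submonoid of all matrices. As a subtype it
carries the entrywise topology; it is a group by the instance below. -/
def unitriangular (n : ℕ) : Submonoid (Matrix (Fin n) (Fin n) ℝ) where
  carrier := {A | (∀ i j, j < i → A i j = 0) ∧ ∀ i, A i i = 1}
  one_mem' := ⟨fun i j h => Matrix.one_apply_ne h.ne', fun i => Matrix.one_apply_eq i⟩
  mul_mem' := by
    rintro A B ⟨hA, hA1⟩ ⟨hB, hB1⟩
    refine ⟨fun i j h => ?_, fun i => ?_⟩
    · rw [Matrix.mul_apply]
      refine Finset.sum_eq_zero fun k _ => ?_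
      rcases lt_or_ge k i with hk | hk
      · rw [hA i k hk, zero_mul]
      · rw [hB k j (h.trans_le hk), mul_zero]
    · rw [Matrix.mul_apply, Finset.sum_eq_single i, hA1, hB1, one_mul]
      · intro k _ hk
        rcases lt_or_gt_of_ne hk with hk | hk
        · rw [hA i k hk, zero_mul]
        · rw [hB k i hk, mul_zero]
      · exact fun h => absurd (Finset.mem_univ i) h

theorem unitriangular_det {n : ℕ} {A : Matrix (Fin n) (Fin n) ℝ} (hA : A ∈ unitriangular n) :
    A.det = 1 := by
  rw [Matrix.det_of_isUpperTriangular (fun i j h => hA.1 i j h)]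
  exact Finset.prod_eq_one fun i _ => hA.2 i

theorem unitriangular_inv_mem {n : ℕ} {A : Matrix (Fin n) (Fin n) ℝ}
    (hA : A ∈ unitriangular n) : A⁻¹ ∈ unitriangular n := by
  have hu : IsUnit A.det := by rw [unitriangular_det hA]; exact isUnit_one
  have hinv : Invertible A := A.invertibleOfIsUnitDet hu
  have htri : ∀ i j : Fin n, j < i → A⁻¹ i j = 0 := fun i j h =>
    Matrix.blockTriangular_inv_of_blockTriangular (b := id) (fun i j h => hA.1 i j h) h
  refine ⟨htri, fun i => ?_⟩
  have h1 : (A * A⁻¹) i i = 1 := by rw [A.mul_nonsing_inv hu, Matrix.one_apply_eq]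
  rw [Matrix.mul_apply, Finset.sum_eq_single i, hA.2, one_mul] at h1
  · exact h1
  · intro k _ hk
    rcases lt_or_gt_of_ne hk with hk | hk
    · rw [hA.1 i k hk, zero_mul]
    · rw [htri k i hk, mul_zero]
  · exact fun h => absurd (Finset.mem_univ i) h

/-- Upper unitriangular matrices form a group under matrix multiplication and inversion. -/
noncomputable instance unitriangularGroup (n : ℕ) : Group (unitriangular n) :=
  { (inferInstance : Monoid (unitriangular n)) with
    inv := fun A => ⟨(A : Matrix (Fin n) (Fin n) ℝ)⁻¹, unitriangular_inv_mem A.2⟩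
    inv_mul_cancel := fun A => Subtype.ext
      (Matrix.nonsing_inv_mul _ (by rw [unitriangular_det A.2]; exact isUnit_one)) }

/-! For real-valued maps, degree at most `d` means that `d + 1` differences vanish, and products
obey a discrete Leibniz rule (`IsKilledByDiffs.mul`). From entries to matrices: for large `D`, entry
`(i, j)` has degree at most `D * (j - i)`. These weights add up along `i < k < j`, so they survive
products and inverses, and every left or right difference lowers all of them by one
(`HasEntryWeights.leftDiff`, `HasEntryWeights.rightDiff`). After finitely many differences only the
identity is left. From matrices to entries: `f (s + t) = leftDiff s f t * f t` writes the difference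
of an entry through entries of a map of lower degree and entries of `f` nearer the diagonal; a
double induction applies. A continuous map killed by differences is an ordinary polynomial: Newton's
formula on grids and density settle one variable, Lagrange interpolation adds further ones. -/

/-- All `k`-fold iterated differences of the real-valued function `g` vanish. -/
def IsKilledByDiffs {S : Type*} [AddCommSemigroup S] : ℕ → (S → ℝ) → Prop
  | 0, g => ∀ t, g t = 0
  | k + 1, g => ∀ s : S, IsKilledByDiffs k (fun t => g (s + t) - g t)

namespace IsKilledByDiffs

/-! ### Calculus of iterated differences -/

section Algebra

variable {S : Type*} [AddCommSemigroup S]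

theorem of_eq_zero (k : ℕ) {g : S → ℝ} (hg : ∀ t, g t = 0) : IsKilledByDiffs k g := by
  induction k generalizing g with
  | zero => exact hg
  | succ k ih => exact fun s => ih fun t => by simp [hg]

theorem const (c : ℝ) : IsKilledByDiffs 1 (fun _ : S => c) := fun _ _ => sub_self c

theorem succ {k : ℕ} {g : S → ℝ} (hg : IsKilledByDiffs k g) : IsKilledByDiffs (k + 1) g := by
  induction k generalizing g with
  | zero => exact of_eq_zero 1 hg
  | succ k ih => exact fun s => ih (hg s)

theorem mono {k l : ℕ} {g : S → ℝ} (hg : IsKilledByDiffs k g) (h : k ≤ l) :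
    IsKilledByDiffs l g := by
  induction h with
  | refl => exact hg
  | step _ ih => exact ih.succ

theorem add {k : ℕ} {g h : S → ℝ} (hg : IsKilledByDiffs k g) (hh : IsKilledByDiffs k h) :
    IsKilledByDiffs k (fun t => g t + h t) := by
  induction k generalizing g h with
  | zero => exact fun t => by simp only [hg t, hh t, add_zero]
  | succ k ih =>
    intro s
    convert ih (hg s) (hh s) using 2
    ring

theorem neg {k : ℕ} {g : S → ℝ} (hg : IsKilledByDiffs k g) :
    IsKilledByDiffs k (fun t => -g t) := by
  induction k generalizing g with
  | zero => exact fun t => by simp only [hg t, neg_zero]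
  | succ k ih =>
    intro s
    convert ih (hg s) using 2
    ring

theorem sum {k : ℕ} {ι : Type*} (A : Finset ι) {g : ι → S → ℝ}
    (hg : ∀ i ∈ A, IsKilledByDiffs k (g i)) : IsKilledByDiffs k (fun t => ∑ i ∈ A, g i t) := by
  classical
  induction A using Finset.induction_on with
  | empty => exact of_eq_zero k fun t => by simp
  | insert a A ha ih =>
    simp only [Finset.sum_insert ha]
    exact (hg a (Finset.mem_insert_self a A)).add
      (ih fun i hi => hg i (Finset.mem_insert_of_mem hi))

/-- Leibniz: Δ(gh) = Δg Δh + Δg h + g Δh. Degrees `a - 1` and `b - 1` add, so `a + b - 1`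
differences suffice. -/
theorem mul {a b c : ℕ} {g h : S → ℝ} (hg : IsKilledByDiffs a g) (hh : IsKilledByDiffs b h)
    (habc : a + b ≤ c + 1) : IsKilledByDiffs c (fun t => g t * h t) := by
  induction c generalizing a b g h with
  | zero =>
    rcases a with _ | a
    · exact fun t => by simp only [hg t, zero_mul]
    · obtain rfl : b = 0 := by omega
      exact fun t => by simp only [hh t, mul_zero]
  | succ c ih =>
    rcases a with _ | a
    · exact of_eq_zero _ fun t => by rw [hg t, zero_mul]
    rcases b with _ | b
    · exact of_eq_zero _ fun t => by rw [hh t, mul_zero]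
    intro s
    convert ((ih (hg s) (hh s) (by omega)).add (ih (hg s) hh (by omega))).add
      (ih hg (hh s) (by omega)) using 2
    ring

/-- The hypothesis says that `φ` is affine with linear part `ψ`; it covers rescaled grids and
coordinate slices. -/
theorem comp {T : Type*} [AddCommSemigroup T] {k : ℕ} {g : S → ℝ} (hg : IsKilledByDiffs k g)
    {φ ψ : T → S} (h : ∀ s t, φ (s + t) = ψ s + φ t) : IsKilledByDiffs k (fun t => g (φ t)) := by
  induction k generalizing g with
  | zero => exact fun t => hg _
  | succ k ih =>
    intro s
    simp only [h]
    exact ih (hg (ψ s))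

theorem iff_isPolyMapNatDegreeLE [Nonempty S] (d : ℕ) (g : S → ℝ) :
    IsPolyMapNatDegreeLE d (fun x => Multiplicative.ofAdd (g x)) ↔
      IsKilledByDiffs (d + 1) g := by
  induction d generalizing g with
  | zero =>
    constructor
    · rintro ⟨c, hc⟩ s t
      have h1 : g (s + t) = g t := Multiplicative.ofAdd.injective ((hc (s + t)).trans (hc t).symm)
      exact sub_eq_zero.2 h1
    · intro h
      obtain ⟨s⟩ := ‹Nonempty S›
      refine ⟨Multiplicative.ofAdd (g s), fun t => congrArg _ ?_⟩
      -- By commutativity both `g t` and `g s` equal `g (s + t)`.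
      have h1 : g (s + t) - g t = 0 := h s t
      have h2 : g (t + s) - g s = 0 := h t s
      rw [add_comm t s] at h2
      linarith
  | succ d ih =>
    refine forall_congr' fun s => ?_
    have hl : leftDiff s (fun x => Multiplicative.ofAdd (g x)) =
        fun t => Multiplicative.ofAdd (g (s + t) - g t) := by
      funext t
      simp [leftDiff, ofAdd_sub, div_eq_mul_inv]
    have hr : rightDiff s (fun x => Multiplicative.ofAdd (g x)) =
        fun t => Multiplicative.ofAdd (g (s + t) - g t) := by
      funext t
      simp [rightDiff, ofAdd_sub, div_eq_inv_mul]
    rw [hl, hr, and_self]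
    exact ih _

theorem exists_of_isPolyMapOfDegreeLE [Nonempty S] {d : WithBot ℕ} {g : S → ℝ}
    (h : IsPolyMapOfDegreeLE d (fun x => Multiplicative.ofAdd (g x))) :
    ∃ k, IsKilledByDiffs k g := by
  induction d using WithBot.recBotCoe with
  | bot => exact ⟨0, fun t => Multiplicative.ofAdd.injective (h t)⟩
  | coe d => exact ⟨d + 1, (iff_isPolyMapNatDegreeLE d g).1 h⟩

theorem isPolyMap [Nonempty S] {k : ℕ} {g : S → ℝ} (h : IsKilledByDiffs k g) :
    IsPolyMap (fun x => Multiplicative.ofAdd (g x)) :=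
  ⟨(k : WithBot ℕ), (iff_isPolyMapNatDegreeLE k g).2 h.succ⟩

end Algebra

/-! ### Continuous maps killed by differences are polynomials -/

section Polynomial

open Polynomial

theorem fwdDiff_iter_eq_zero {k : ℕ} {g : ℕ → ℝ} (hg : IsKilledByDiffs k g) {j : ℕ}
    (hj : k ≤ j) (t : ℕ) : (fwdDiff 1)^[j] g t = 0 := by
  induction j generalizing k g with
  | zero =>
    obtain rfl : k = 0 := by omega
    exact hg t
  | succ j ih =>
    rw [Function.iterate_succ_apply]
    rcases k with _ | k
    · exact ih (of_eq_zero 0 fun t => by simp [fwdDiff, hg _]) (Nat.zero_le j)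
    · refine ih (k := k) ?_ (by omega)
      have h1 : IsKilledByDiffs k fun t => g (1 + t) - g t := hg 1
      simp only [add_comm 1] at h1
      exact h1

/-- Newton's forward difference formula, cut off at `k`. -/
theorem exists_polynomial_nat {k : ℕ} {g : ℕ → ℝ} (hg : IsKilledByDiffs k g) :
    ∃ p : ℝ[X], p.degree < k ∧ ∀ m : ℕ, g m = p.eval (m : ℝ) := by
  refine ⟨∑ j ∈ Finset.range k,
    C ((fwdDiff 1)^[j] g 0 * ((j.factorial : ℝ)⁻¹)) * descPochhammer ℝ j, ?_, fun m => ?_⟩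
  · refine (degree_sum_le _ _).trans_lt ((Finset.sup_lt_iff (WithBot.bot_lt_coe k)).2 ?_)
    intro j hj
    rw [← smul_eq_C_mul]
    refine (degree_smul_le _ _).trans_lt ?_
    refine degree_le_natDegree.trans_lt ?_
    rw [descPochhammer_natDegree]
    exact Nat.cast_lt.2 (Finset.mem_range.1 hj)
  · have h := shift_eq_sum_fwdDiff_iter (h := 1) g m 0
    have h2 : ∑ j ∈ Finset.range (m + 1), m.choose j • (fwdDiff 1)^[j] g 0 =
        ∑ j ∈ Finset.range k, m.choose j • (fwdDiff 1)^[j] g 0 := by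
      rcases le_total k (m + 1) with hk | hk
      · symm
        refine Finset.sum_subset (Finset.range_subset_range.2 hk) fun j _ hj => ?_
        rw [hg.fwdDiff_iter_eq_zero (by simpa using hj), smul_zero]
      · refine Finset.sum_subset (Finset.range_subset_range.2 hk) fun j _ hj => ?_
        rw [Nat.choose_eq_zero_of_lt (by simpa using hj), zero_smul]
    rw [h2] at h
    simp only [smul_eq_mul, mul_one, zero_add] at h
    rw [h, eval_finsetSum]
    refine Finset.sum_congr rfl fun j _ => ?_
    rw [eval_mul, eval_C, descPochhammer_eval_eq_descFactorial,
      Nat.descFactorial_eq_factorial_mul_choose, nsmul_eq_mul]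
    have : (j.factorial : ℝ) ≠ 0 := by positivity
    push_cast
    field_simp

theorem exists_polynomial {k : ℕ} {g : ℝ≥0 → ℝ} (hc : Continuous g) (hg : IsKilledByDiffs k g) :
    ∃ p : ℝ[X], p.degree < k ∧ ∀ x : ℝ≥0, g x = p.eval (x : ℝ) := by
  have H : ∀ m : ℕ, ∃ p : ℝ[X], p.degree < k ∧ ∀ a : ℕ, g (a / (m + 1)) = p.eval (a : ℝ) :=
    fun m => (hg.comp (φ := fun a : ℕ => (a : ℝ≥0) / (m + 1))
      (ψ := fun a : ℕ => (a : ℝ≥0) / (m + 1))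
      fun s t => by push_cast; rw [add_div]).exists_polynomial_nat
  obtain ⟨p, hp, hpe⟩ := H 0
  refine ⟨p, hp, ?_⟩
  have hrat : ∀ a m : ℕ, g (a / (m + 1)) = p.eval ((a : ℝ) / (m + 1)) := by
    intro a m
    obtain ⟨q, -, hq⟩ := H m
    have hm : (m : ℝ) + 1 ≠ 0 := by positivity
    -- The grid of mesh `1 / (m + 1)` contains the integers, so its polynomial, rescaled, agrees
    -- with `p` at infinitely many points.
    have hqp : q.comp (C ((m : ℝ) + 1) * X) = p := by
      refine eq_of_infinite_eval_eq _ _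
        ((Set.infinite_range_of_injective (Nat.cast_injective (R := ℝ))).mono ?_)
      rintro _ ⟨b, rfl⟩
      have h1 := hq ((m + 1) * b)
      have h2 := hpe b
      have h3 : (((m + 1) * b : ℕ) : ℝ≥0) / (m + 1) = b := by
        push_cast
        exact mul_div_cancel_left₀ _ (by positivity)
      rw [h3] at h1
      simp only [Nat.cast_zero, zero_add, div_one] at h2
      simp only [Set.mem_ofPred_eq, eval_comp, eval_mul, eval_C, eval_X]
      rw [← h2, h1]
      push_cast
      rfl
    rw [hq a, ← hqp]
    simp only [eval_comp, eval_mul, eval_C, eval_X]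
    rw [mul_div_cancel₀ _ hm]
  have hd : Dense (Set.range fun a : ℕ × ℕ => (a.1 : ℝ≥0) / (a.2 + 1)) := by
    refine dense_of_exists_between fun x y hxy => ?_
    obtain ⟨q, hq, hxq, hqy⟩ := (NNReal.lt_iff_exists_rat_btwn x y).1 hxy
    lift q to ℚ≥0 using hq
    refine ⟨_, ⟨(q.num, q.den - 1), rfl⟩, ?_⟩
    have h : Real.toNNReal ((q : ℚ) : ℝ) = (q.num : ℝ≥0) / ((q.den - 1 : ℕ) + 1) := by
      rw [← Nat.cast_add_one, Nat.sub_add_cancel q.den_pos]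
      apply NNReal.eq
      rw [Real.coe_toNNReal _ (by positivity), NNReal.coe_div, NNReal.coe_natCast,
        NNReal.coe_natCast, ← NNRat.cast_def]
      norm_cast
    exact ⟨hxq.trans_eq h, h.symm.trans_lt hqy⟩
  have heq := Continuous.ext_on hd (f := g) (g := fun x : ℝ≥0 => p.eval (x : ℝ)) hc
    (p.continuous.comp NNReal.continuous_coe) ?_
  · exact fun x => congrFun heq x
  · rintro _ ⟨⟨a, m⟩, rfl⟩
    simp [hrat]

theorem exists_mvPolynomial {k N : ℕ} {g : (Fin N → ℝ≥0) → ℝ} (hc : Continuous g)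
    (hg : IsKilledByDiffs k g) :
    ∃ p : MvPolynomial (Fin N) ℝ, ∀ x : Fin N → ℝ≥0,
      g x = MvPolynomial.eval (fun i => (x i : ℝ)) p := by
  induction N with
  | zero =>
    refine ⟨MvPolynomial.C (g 0), fun x => ?_⟩
    rw [MvPolynomial.eval_C, Subsingleton.elim x 0]
  | succ N ih =>
    have hslice : ∀ a : ℝ≥0, ∃ p : MvPolynomial (Fin N) ℝ, ∀ x : Fin N → ℝ≥0,
        g (Fin.cons a x) = MvPolynomial.eval (fun i => (x i : ℝ)) p := fun a =>
      ih (g := fun x => g (Fin.cons a x)) (hc.comp (by fun_prop))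
        (hg.comp (φ := fun x : Fin N → ℝ≥0 => (Fin.cons a x : Fin (N + 1) → ℝ≥0))
          (ψ := fun x => Fin.cons 0 x) fun s t => by
            funext i; refine Fin.cases ?_ (fun i => ?_) i <;> simp)
    choose q hq using hslice
    let v : ℕ → ℝ := fun i => (i : ℝ)
    have hv : Set.InjOn v (Finset.range k : Set ℕ) := Nat.cast_injective.injOn
    -- In the first variable the degree is below `k` whatever the others are, so the slices at `0,
    -- ..., k - 1` determine `g`.
    refine ⟨∑ i ∈ Finset.range k, MvPolynomial.rename Fin.succ (q i) *
      Polynomial.aeval (MvPolynomial.X 0) (Lagrange.basis (Finset.range k) v i), fun x => ?_⟩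
    obtain ⟨p, hp, hpe⟩ := exists_polynomial (k := k)
      (g := fun a => g (Fin.cons a (Fin.tail x))) (hc.comp (by fun_prop))
      (hg.comp (φ := fun a : ℝ≥0 => (Fin.cons a (Fin.tail x) : Fin (N + 1) → ℝ≥0))
        (ψ := fun a => Fin.cons a 0) fun s t => by
          funext i; refine Fin.cases ?_ (fun i => ?_) i <;> simp)
    have hL := Lagrange.eq_interpolate_of_eval_eq (fun i : ℕ => g (Fin.cons (i : ℝ≥0) (Fin.tail x)))
      hv (f := p) (by simpa using hp) (fun i _ => by simp [v, hpe])
    have hx := hpe (x 0)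
    rw [Fin.cons_self_tail] at hx
    rw [hx, hL, Lagrange.interpolate_apply, eval_finsetSum, map_sum]
    refine Finset.sum_congr rfl fun i _ => ?_
    rw [eval_mul, eval_C, map_mul, MvPolynomial.eval_rename, hq]
    congr 1
    have := Polynomial.map_aeval_eq_aeval_map (R := ℝ) (S := MvPolynomial (Fin (N + 1)) ℝ) (T := ℝ)
      (U := ℝ) (φ := RingHom.id ℝ) (ψ := MvPolynomial.eval (fun i => (x i : ℝ))) (by ext; simp)
      (Lagrange.basis (Finset.range k) v i) (MvPolynomial.X 0)
    rw [this]
    simp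

end Polynomial

end IsKilledByDiffs

/-! ### From polynomial entries to polynomial matrix maps -/

section Matrices

variable {S : Type*} [AddCommSemigroup S] {n : ℕ}

/-- The off-diagonal entries `(i, j)` of `f` are killed by `D * (j - i) + 1 - m` differences. -/
def HasEntryWeights (D m : ℕ) (f : S → unitriangular n) : Prop :=
  ∀ i j : Fin n, i < j →
    IsKilledByDiffs (D * ((j : ℕ) - i) + 1 - m) fun t => (f t : Matrix (Fin n) (Fin n) ℝ) i j

theorem mul_sub_add_mul_sub (D : ℕ) {i k j : Fin n} (hik : i < k) (hkj : k < j) :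
    D * ((k : ℕ) - i) + D * ((j : ℕ) - k) = D * ((j : ℕ) - i) := by
  rw [← mul_add]
  congr 1
  have : (i : ℕ) < k := hik
  have : (k : ℕ) < j := hkj
  omega

theorem HasEntryWeights.inv {D m : ℕ} {f : S → unitriangular n} (hf : HasEntryWeights D m f) :
    HasEntryWeights D m (fun t => (f t)⁻¹) := by
  have key : ∀ l : ℕ, ∀ i j : Fin n, i < j → (j : ℕ) - i ≤ l →
      IsKilledByDiffs (D * ((j : ℕ) - i) + 1 - m)
        fun t => (((f t)⁻¹ : unitriangular n) : Matrix (Fin n) (Fin n) ℝ) i j := by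
    intro l
    induction l with
    | zero =>
      intro i j hij h
      have : (i : ℕ) < j := hij
      omega
    | succ l ih =>
      intro i j hij h
      -- Row `i` of `f t * (f t)⁻¹ = 1` expresses this entry through entries of the inverse nearer
      -- the diagonal.
      have hB : ∀ t, (((f t)⁻¹ : unitriangular n) : Matrix (Fin n) (Fin n) ℝ) i j =
          -∑ k ∈ Finset.univ.erase i, (f t : Matrix (Fin n) (Fin n) ℝ) i k *
            (((f t)⁻¹ : unitriangular n) : Matrix (Fin n) (Fin n) ℝ) k j := by
        intro t
        have h1 : ((f t * (f t)⁻¹ : unitriangular n) : Matrix (Fin n) (Fin n) ℝ) i j = 0 := by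
          rw [mul_inv_cancel]
          exact Matrix.one_apply_ne hij.ne
        rw [Submonoid.coe_mul, Matrix.mul_apply, ← Finset.add_sum_erase _ _ (Finset.mem_univ i),
          (f t).2.2 i, one_mul] at h1
        linarith
      simp only [hB]
      refine (IsKilledByDiffs.sum _ fun k hk => ?_).neg
      rcases lt_or_gt_of_ne (Finset.ne_of_mem_erase hk) with hki | hik
      · exact IsKilledByDiffs.of_eq_zero _ fun t => by rw [(f t).2.1 i k hki, zero_mul]
      rcases lt_trichotomy k j with hkj | rfl | hjk
      · have h1 : (i : ℕ) < k := hik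
        have h2 := mul_sub_add_mul_sub D hik hkj
        exact (hf i k hik).mul (ih k j hkj (by omega)) (by omega)
      · simp only [((f _)⁻¹).2.2 k, mul_one]
        exact hf i k hik
      · exact IsKilledByDiffs.of_eq_zero _ fun t => by rw [((f t)⁻¹).2.1 k j hjk, mul_zero]
  exact fun i j hij => key _ i j hij le_rfl

theorem leftDiff_apply_of_lt (f : S → unitriangular n) (s t : S) {i j : Fin n} (hij : i < j) :
    ((leftDiff s f t : unitriangular n) : Matrix (Fin n) (Fin n) ℝ) i j =
      ∑ k, ((f (s + t) : Matrix (Fin n) (Fin n) ℝ) i k - (f t : Matrix (Fin n) (Fin n) ℝ) i k) *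
        (((f t)⁻¹ : unitriangular n) : Matrix (Fin n) (Fin n) ℝ) k j := by
  have h1 : ((f t * (f t)⁻¹ : unitriangular n) : Matrix (Fin n) (Fin n) ℝ) i j = 0 := by
    rw [mul_inv_cancel]
    exact Matrix.one_apply_ne hij.ne
  rw [Submonoid.coe_mul, Matrix.mul_apply] at h1
  simp only [sub_mul, Finset.sum_sub_distrib, h1, sub_zero]
  rw [leftDiff, Submonoid.coe_mul, Matrix.mul_apply]

theorem rightDiff_apply_of_lt (f : S → unitriangular n) (s t : S) {i j : Fin n} (hij : i < j) :
    ((rightDiff s f t : unitriangular n) : Matrix (Fin n) (Fin n) ℝ) i j =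
      ∑ k, (((f t)⁻¹ : unitriangular n) : Matrix (Fin n) (Fin n) ℝ) i k *
        ((f (s + t) : Matrix (Fin n) (Fin n) ℝ) k j -
          (f t : Matrix (Fin n) (Fin n) ℝ) k j) := by
  have h1 : (((f t)⁻¹ * f t : unitriangular n) : Matrix (Fin n) (Fin n) ℝ) i j = 0 := by
    rw [inv_mul_cancel]
    exact Matrix.one_apply_ne hij.ne
  rw [Submonoid.coe_mul, Matrix.mul_apply] at h1
  simp only [mul_sub, Finset.sum_sub_distrib, h1, sub_zero]
  rw [rightDiff, Submonoid.coe_mul, Matrix.mul_apply]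

theorem HasEntryWeights.entry_diff {D m : ℕ} {f : S → unitriangular n}
    (hf : HasEntryWeights D m f) (s : S) {i j : Fin n} (hij : i < j) :
    IsKilledByDiffs (D * ((j : ℕ) - i) - m) fun t =>
      (f (s + t) : Matrix (Fin n) (Fin n) ℝ) i j - (f t : Matrix (Fin n) (Fin n) ℝ) i j := by
  have h := hf i j hij
  rcases Nat.lt_or_ge (D * ((j : ℕ) - i)) m with hm | hm
  · rw [Nat.sub_eq_zero_of_le (by omega)] at h
    exact IsKilledByDiffs.of_eq_zero _ fun t => sub_eq_zero.2 ((h _).trans (h t).symm)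
  · rw [show D * ((j : ℕ) - i) + 1 - m = D * ((j : ℕ) - i) - m + 1 by omega] at h
    exact h s

theorem HasEntryWeights.leftDiff {D m : ℕ} {f : S → unitriangular n}
    (hf : HasEntryWeights D m f) (s : S) : HasEntryWeights D (m + 1) (leftDiff s f) := by
  intro i j hij
  simp only [leftDiff_apply_of_lt f s _ hij, Nat.add_sub_add_right]
  refine IsKilledByDiffs.sum _ fun k _ => ?_
  rcases lt_trichotomy k i with hki | rfl | hik
  · exact IsKilledByDiffs.of_eq_zero _ fun t => by
      rw [(f t).2.1 i k hki, (f (s + t)).2.1 i k hki, sub_zero, zero_mul]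
  · exact IsKilledByDiffs.of_eq_zero _ fun t => by
      rw [(f t).2.2 k, (f (s + t)).2.2 k, sub_self, zero_mul]
  rcases lt_trichotomy k j with hkj | rfl | hjk
  · have h2 := mul_sub_add_mul_sub D hik hkj
    exact (hf.entry_diff s hik).mul (hf.inv k j hkj) (by omega)
  · simp only [((f _)⁻¹).2.2 k, mul_one]
    exact hf.entry_diff s hik
  · exact IsKilledByDiffs.of_eq_zero _ fun t => by rw [((f t)⁻¹).2.1 k j hjk, mul_zero]

theorem HasEntryWeights.rightDiff {D m : ℕ} {f : S → unitriangular n}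
    (hf : HasEntryWeights D m f) (s : S) : HasEntryWeights D (m + 1) (rightDiff s f) := by
  intro i j hij
  simp only [rightDiff_apply_of_lt f s _ hij, Nat.add_sub_add_right]
  refine IsKilledByDiffs.sum _ fun k _ => ?_
  rcases lt_trichotomy j k with hjk | rfl | hkj
  · exact IsKilledByDiffs.of_eq_zero _ fun t => by
      rw [(f t).2.1 k j hjk, (f (s + t)).2.1 k j hjk, sub_zero, mul_zero]
  · exact IsKilledByDiffs.of_eq_zero _ fun t => by
      rw [(f t).2.2 j, (f (s + t)).2.2 j, sub_self, mul_zero]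
  rcases lt_trichotomy i k with hik | rfl | hki
  · have h2 := mul_sub_add_mul_sub D hik hkj
    exact (hf.inv i k hik).mul (hf.entry_diff s hkj) (by omega)
  · simp only [((f _)⁻¹).2.2 i, one_mul]
    exact hf.entry_diff s hkj
  · exact IsKilledByDiffs.of_eq_zero _ fun t => by rw [((f t)⁻¹).2.1 i k hki, zero_mul]

theorem HasEntryWeights.isPolyMapNatDegreeLE {D m e : ℕ} {f : S → unitriangular n}
    (hf : HasEntryWeights D m f) (h : D * n + 1 ≤ m + e) : IsPolyMapNatDegreeLE e f := by
  induction e generalizing m f with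
  | zero =>
    -- Here `m` exceeds `D * n`, so the truncated count is `0` and every off-diagonal entry
    -- vanishes.
    refine ⟨1, fun t => Subtype.ext (Matrix.ext fun i j => ?_)⟩
    change _ = (1 : Matrix (Fin n) (Fin n) ℝ) i j
    rcases lt_trichotomy j i with hji | rfl | hij
    · rw [(f t).2.1 i j hji, Matrix.one_apply_ne hji.ne']
    · rw [(f t).2.2 j, Matrix.one_apply_eq]
    · have h1 := hf i j hij
      have h2 : D * ((j : ℕ) - i) ≤ D * n := Nat.mul_le_mul_left _ (by omega)
      rw [Nat.sub_eq_zero_of_le (by omega)] at h1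
      exact (h1 t).trans (Matrix.one_apply_ne hij.ne).symm
  | succ e ih =>
    exact fun s => ⟨ih (hf.leftDiff s) (by omega), ih (hf.rightDiff s) (by omega)⟩

theorem isPolyMap_of_entries {f : S → unitriangular n}
    (hf : ∀ i j : Fin n, i < j → ∃ k, IsKilledByDiffs k
      fun t => (f t : Matrix (Fin n) (Fin n) ℝ) i j) : IsPolyMap f := by
  have hf' : ∀ i j : Fin n, ∃ k, i < j → IsKilledByDiffs k
      fun t => (f t : Matrix (Fin n) (Fin n) ℝ) i j := by
    intro i j
    by_cases hij : i < j
    · exact (hf i j hij).imp fun k hk _ => hk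
    · exact ⟨0, fun h => absurd h hij⟩
  choose k hk using hf'
  -- `D` bounds every `k i j`, and `j - i ≥ 1`, so the weights hold with `m = 0`.
  let D := ∑ i, ∑ j, k i j
  have hD : ∀ i j, k i j ≤ D := fun i j =>
    (Finset.single_le_sum (f := fun j => k i j) (fun _ _ => Nat.zero_le _)
      (Finset.mem_univ j)).trans
    (Finset.single_le_sum (f := fun i => ∑ j, k i j) (fun _ _ => Nat.zero_le _)
      (Finset.mem_univ i))
  have hw : HasEntryWeights D 0 f := by
    intro i j hij
    refine (hk i j hij).mono ?_
    have h1 : D * 1 ≤ D * ((j : ℕ) - i) := Nat.mul_le_mul_left _ (by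
      have : (i : ℕ) < j := hij
      omega)
    have := hD i j
    omega
  exact ⟨((D * n + 1 : ℕ) : WithBot ℕ), hw.isPolyMapNatDegreeLE (e := D * n + 1) (by omega)⟩

/-! ### From polynomial matrix maps to polynomial entries -/

theorem entry_diff_eq (f : S → unitriangular n) (s t : S) {i j : Fin n} :
    (f (s + t) : Matrix (Fin n) (Fin n) ℝ) i j - (f t : Matrix (Fin n) (Fin n) ℝ) i j =
      ∑ k ∈ Finset.univ.erase i, ((leftDiff s f t : unitriangular n) : Matrix (Fin n) (Fin n) ℝ) i k *
        (f t : Matrix (Fin n) (Fin n) ℝ) k j := by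
  have h1 : f (s + t) = leftDiff s f t * f t := by simp [leftDiff]
  rw [h1, Submonoid.coe_mul, Matrix.mul_apply, ← Finset.add_sum_erase _ _ (Finset.mem_univ i),
    (leftDiff s f t).2.2 i, one_mul, add_sub_cancel_left]

/-- The number of differences killing the entries is bounded in terms of the degree alone. -/
theorem exists_entries_isKilledByDiffs (S : Type*) [AddCommSemigroup S] (n d : ℕ) :
    ∃ E, ∀ f : S → unitriangular n, IsPolyMapNatDegreeLE d f → ∀ i j : Fin n, i < j →
      IsKilledByDiffs E fun t => (f t : Matrix (Fin n) (Fin n) ℝ) i j := by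
  induction d with
  | zero =>
    refine ⟨1, ?_⟩
    rintro f ⟨c, hc⟩ i j -
    simp only [hc]
    exact IsKilledByDiffs.const _
  | succ d ih =>
    obtain ⟨E, hE⟩ := ih
    -- Inner induction on the distance to the diagonal. The bound must not depend on `f`, since it
    -- is applied to `leftDiff s f` for all `s` at once.
    have key : ∀ l : ℕ, ∃ E', ∀ f : S → unitriangular n, IsPolyMapNatDegreeLE (d + 1) f →
        ∀ i j : Fin n, i < j → (j : ℕ) - i ≤ l →
        IsKilledByDiffs E' fun t => (f t : Matrix (Fin n) (Fin n) ℝ) i j := by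
      intro l
      induction l with
      | zero =>
        refine ⟨0, fun f _ i j hij h => ?_⟩
        have : (i : ℕ) < j := hij
        omega
      | succ l ih =>
        obtain ⟨E', hE'⟩ := ih
        -- One difference in `s`; `E + E'` then kill the products.
        refine ⟨E + E' + 1, fun f hf i j hij h s => ?_⟩
        simp only [entry_diff_eq f s]
        refine IsKilledByDiffs.sum _ fun k hk => ?_
        rcases lt_or_gt_of_ne (Finset.ne_of_mem_erase hk) with hki | hik
        · exact IsKilledByDiffs.of_eq_zero _ fun t => by
            rw [(leftDiff s f t).2.1 i k hki, zero_mul]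
        have hP := hE _ (hf s).1 i k hik
        rcases lt_trichotomy k j with hkj | rfl | hjk
        · have h1 : (i : ℕ) < k := hik
          exact hP.mul (hE' f hf k j hkj (by omega)) (by omega)
        · simp only [(f _).2.2 k, mul_one]
          exact hP.mono (by omega)
        · exact IsKilledByDiffs.of_eq_zero _ fun t => by rw [(f t).2.1 k j hjk, mul_zero]
    obtain ⟨E', hE'⟩ := key n
    exact ⟨E', fun f hf i j hij => hE' f hf i j hij (by omega)⟩

theorem IsPolyMap.exists_entry_isKilledByDiffs {f : S → unitriangular n} (hf : IsPolyMap f)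
    {i j : Fin n} (hij : i < j) :
    ∃ k, IsKilledByDiffs k fun t => (f t : Matrix (Fin n) (Fin n) ℝ) i j := by
  obtain ⟨d, hd⟩ := hf
  have h : ∃ e, IsPolyMapNatDegreeLE e f := by
    induction d using WithBot.recBotCoe with
    | bot => exact ⟨0, 1, hd⟩
    | coe d => exact ⟨d, hd⟩
  obtain ⟨e, he⟩ := h
  obtain ⟨E, hE⟩ := exists_entries_isKilledByDiffs S n e
  exact ⟨E, hE f he i j hij⟩

theorem continuous_of_entries {X : Type*} [TopologicalSpace X] {f : X → unitriangular n}
    (hf : ∀ i j : Fin n, i < j → Continuous fun x => (f x : Matrix (Fin n) (Fin n) ℝ) i j) :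
    Continuous f := by
  refine Continuous.subtype_mk (continuous_matrix fun i j => ?_) _
  rcases lt_trichotomy j i with hji | rfl | hij
  · simp only [(f _).2.1 i j hji]
    exact continuous_const
  · simp only [(f _).2.2 j]
    exact continuous_const
  · exact hf i j hij

end Matrices

theorem mainTheorem6 (N n : ℕ) :
    (∀ (d : Fin n → Fin n → WithBot ℕ) (g : Fin n → Fin n → (Fin N → ℝ≥0) → ℝ),
      (∀ i j, i < j → Continuous (g i j) ∧
        IsPolyMapOfDegreeLE (d i j) (fun x => Multiplicative.ofAdd (g i j x))) →
      ∀ f : (Fin N → ℝ≥0) → unitriangular n,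
        (∀ x i j, i < j → (f x : Matrix (Fin n) (Fin n) ℝ) i j = g i j x) →
        Continuous f ∧ IsPolyMap f) ∧
    (∀ f : (Fin N → ℝ≥0) → unitriangular n, Continuous f → IsPolyMap f →
      ∀ i j, i < j →
        Continuous (fun x => (f x : Matrix (Fin n) (Fin n) ℝ) i j) ∧
        IsPolyMap (fun x => Multiplicative.ofAdd ((f x : Matrix (Fin n) (Fin n) ℝ) i j)) ∧
        ∃ p : MvPolynomial (Fin N) ℝ, ∀ x : Fin N → ℝ≥0,
          (f x : Matrix (Fin n) (Fin n) ℝ) i j = MvPolynomial.eval (fun k => (x k : ℝ)) p) := by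
  refine ⟨fun d g hg f hf => ?_, fun f hc hf i j hij => ?_⟩
  · have hentry : ∀ i j, i < j →
        (fun x => (f x : Matrix (Fin n) (Fin n) ℝ) i j) = g i j :=
      fun i j hij => funext fun x => hf x i j hij
    constructor
    · exact continuous_of_entries fun i j hij => by rw [hentry i j hij]; exact (hg i j hij).1
    · exact isPolyMap_of_entries fun i j hij => by
        rw [hentry i j hij]
        exact IsKilledByDiffs.exists_of_isPolyMapOfDegreeLE (hg i j hij).2
  · obtain ⟨k, hk⟩ := hf.exists_entry_isKilledByDiffs hij
    have hcont : Continuous fun x => (f x : Matrix (Fin n) (Fin n) ℝ) i j :=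
      (continuous_subtype_val.comp hc).matrix_elem i j
    exact ⟨hcont, hk.isPolyMap, hk.exists_mvPolynomial hcont⟩
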